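/- **Setting.** Let $\Theta\subseteq\mathbb R$, let $X_1,X_2,\dots$ be real random variables whose joint law $\Pr\{\cdot\mid\theta\}$ depends on $\theta\in\Theta$, and let $m\ge 2$. Let $\theta_i$ and $\theta_i',\theta_i''\in\Theta$ ($1\le i\le m-1$) satisfy $\theta_i'<\theta_i<\theta_i''$ for all $i$ and $\theta_i''\le\theta_{i+1}'$ for $i\le m-2$; put $\theta_0'=-\infty$, $\theta_m''=\infty$. The hypotheses are $H_i:\theta\in\Theta_i$, $0\le i\le m-1$, with $\Theta_0=\{\theta\in\Theta:\theta\le\theta_1\}$, $\Theta_i=\{\theta\in\Theta:\theta_i<\theta\le\theta_{i+1}\}$ for $1\le i\le m-2$, $\Theta_{m-1}=\{\theta\in\Theta:\theta>\theta_{m-1}\}$. Let $\varTheta_0=\{\theta\in\Theta_0:\theta\le\theta_1'\}$, $\varTheta_i=\{\theta\in\Theta_i:\theta_i''\le\theta\le\theta_{i+1}'\}$ for $1\le i\le m-2$, and $\varTheta_{m-1}=\{\theta\in\Theta_{m-1}:\theta\ge\theta_{m-1}''\}$. Let $\boldsymbol\varphi_n=\varphi(X_1,\dots,X_n)$ be a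 unimodal-likelihood consistent estimator of $\theta$: for each $n\ge1$ and each observable $(x_1,\dots,x_n)$, the likelihood (the joint probability mass function if the observations are discrete, the joint probability density if they are continuous) is non-decreasing in $\theta\in\Theta$ for $\theta\le\varphi(x_1,\dots,x_n)$ and non-increasing for $\theta\ge\varphi(x_1,\dots,x_n)$, and $\boldsymbol\varphi_n\to\theta$ in probability under each $\theta\in\Theta$. For $\delta\in(0,1)$ and $n\ge1$ let $L(\boldsymbol\varphi_n,n,\delta)\le\boldsymbol\varphi_n\le U(\boldsymbol\varphi_n,n,\delta)$ surely be confidence limits (possibly infinite) with $\Pr\{\theta\le L(\boldsymbol\varphi_n,n,\delta)\mid\theta\}\le\delta$ and $\Pr\{\theta\ge U(\boldsymbol\varphi_n,n,\delta)\mid\theta\}\le\delta$ for all $\theta\in\Theta$. Call them *nested* if, surely, $L(\boldsymbol\varphi_n,n,\delta)$ is non-decreasing and $U(\boldsymbol\varphi_n,n,\delta)$ is non-increasing in $\delta\in(0,1)$ for every $n$. Let $\zeta$ range over an interval $(0,\zeta_0)$. For each $\zeta$ let $\alpha_i,\beta_i\in(0,1)$, $1\le i\le m-1$, depend on $\zeta$,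 with $\alpha_i=O(\zeta)$ and $\beta_i=O(\zeta)$ as $\zeta\to0$; let $\alpha_0=\alpha_1$, $\beta_m=\beta_{m-1}$, $\alpha_m=\beta_0=0$. Fix a number $s\ge1$ of stages. For each $\zeta$ let $n_1<\dots<n_s$ be positive integers (which may depend on $\zeta$) such that $n_s$ is no less than the smallest positive integer $n$ for which each of the events $\{\theta_i'\le L(\boldsymbol\varphi_n,n,\alpha_i)\le U(\boldsymbol\varphi_n,n,\beta_i)\le\theta_i''\}$, $1\le i\le m-1$, is non-empty (such an $n$ is assumed to exist). Put $\widehat{\boldsymbol\theta}_\ell=\boldsymbol\varphi_{n_\ell}$, and let the decision variable $D_\ell\in\{0,\dots,m\}$ be a measurable function of $X_1,\dots,X_{n_\ell}$ (which may depend on $\zeta$) such that $$\{D_\ell=i\}\subseteq\{\theta_{i-1}'\le L(\widehat{\boldsymbol\theta}_\ell,n_\ell,\alpha_{i-1})\le U(\widehat{\boldsymbol\theta}_\ell,n_\ell,\beta_i)\le\theta_i''\},\qquad 1\le i\le m,\ 1\le\ell\le s,$$ and $\Pr\{D_s=0\mid\theta\}=0$ for all $\theta\in\Theta$. Sampling stops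 at the first stage $\ell$ with $D_\ell\ne0$; then $H_{D_\ell-1}$ is accepted and every other hypothesis is rejected. Let $\widehat{\boldsymbol\theta}$ be the value of $\widehat{\boldsymbol\theta}_\ell$ at the stopping stage. **Claim.** The following hold for every $\zeta\in(0,\zeta_0)$ (with the limit $\zeta\to0$ in (VI)). (I) $\Pr\{\text{Reject }H_0\mid\theta\}$ is non-decreasing in $\theta\in\varTheta_0$. (II) $\Pr\{\text{Reject }H_{m-1}\mid\theta\}$ is non-increasing in $\theta\in\varTheta_{m-1}$. (III) If $m=2$ or the confidence limits are nested, then $\Pr\{\text{Reject }H_i\mid\theta\}\le s\,(\max\{\alpha_j:i<j\le m\}+\max\{\beta_j:0\le j\le i\})$ for all $\theta\in\varTheta_i$, $0\le i\le m-1$. (IV) For $0<i\le m-1$, $\Pr\{\text{Accept }H_i\mid\theta\}$ is at most $s\alpha_i$ and is non-decreasing in $\theta\in\Theta$ for $\theta\le\theta_i'$. (V) For $0\le i\le m-2$, $\Pr\{\text{Accept }H_i\mid\theta\}$ is at most $s\beta_{i+1}$ and is non-increasing in $\theta\in\Theta$ for $\theta\ge\theta_{i+1}''$. (VI) If, for each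 $\theta\in\Theta$, $X_1,X_2,\dots$ are i.i.d. with $\mathbb E[e^{\rho X_1}]<\infty$ for all $\rho\in\mathbb R$, and $\boldsymbol\varphi_n=\frac1n\sum_{i=1}^nX_i$ is an unbiased estimator of $\theta$, then $\lim_{\zeta\to0}\Pr\{\text{Reject }H_i\mid\theta\}=0$ for all $\theta\in\varTheta_i$, $0\le i\le m-1$. Moreover, for $m\ge3$: (VII) For $1\le i\le m-2$, $a,b\in\varTheta_i$ and $\theta\in\Theta$ with $a\le\theta\le b$, $$\Pr\{\text{Reject }H_i\mid\theta\}\le\Pr\{\text{Reject }H_i,\ \widehat{\boldsymbol\theta}\le a\mid a\}+\Pr\{\text{Reject }H_i,\ \widehat{\boldsymbol\theta}\ge b\mid b\},$$ and, if $a<b$, $$\Pr\{\text{Reject }H_i\mid\theta\}\ge\Pr\{\text{Reject }H_i,\ \widehat{\boldsymbol\theta}\le a\mid b\}+\Pr\{\text{Reject }H_i,\ \widehat{\boldsymbol\theta}\ge b\mid a\}.$$ (VIII) $\Pr\{\text{Reject }H_0\text{ and }H_{m-1}\mid\theta\}$ is non-decreasing in $\theta\in\varTheta_0$ and non-increasing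 in $\theta\in\varTheta_{m-1}$. (IX) If $m=3$ or the confidence limits are nested, then $\Pr\{\text{Reject }H_0\text{ and }H_{m-1}\mid\theta\}$ is at most $s\max\{\alpha_i:1\le i\le m-2\}$ for $\theta\in\varTheta_0$ and at most $s\max\{\beta_i:2\le i\le m-1\}$ for $\theta\in\varTheta_{m-1}$. -/

import Mathlib

open MeasureTheory ProbabilityTheory Filter Topology Asymptotics
open scoped ENNReal

namespace InclusionTest

variable {Ω : Type*}

/-- The tuple of the first `n` observations; `X k` is the `(k + 1)`-st observation. -/
def sample (X : ℕ → Ω → ℝ) (n : ℕ) (ω : Ω) : Fin n → ℝ := fun k => X k ω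

/-- `φ` evaluated at the first `n` observations. -/
def estimate (X : ℕ → Ω → ℝ) (φ : (n : ℕ) → (Fin n → ℝ) → ℝ) (n : ℕ) (ω : Ω) : ℝ :=
  φ n (sample X n ω)

/-- `f x θ` is the likelihood of the random tuple `Y`: either all laws of `Y` are discrete and
`f` is the joint probability mass function, or all laws are absolutely continuous with respect
to Lebesgue measure and `f` is a joint probability density function. -/
def IsLikelihood [MeasurableSpace Ω] (P : ℝ → Measure Ω) (Θ : Set ℝ) {n : ℕ}
    (Y : Ω → Fin n → ℝ) (f : (Fin n → ℝ) → ℝ → ℝ≥0∞) : Prop :=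
  (∀ θ ∈ Θ, (∃ S : Set (Fin n → ℝ), S.Countable ∧ P θ {ω | Y ω ∉ S} = 0) ∧
      ∀ x, f x θ = P θ {ω | Y ω = x}) ∨
  (∀ θ ∈ Θ, Measurable (fun x => f x θ) ∧
      (P θ).map Y = (volume : Measure (Fin n → ℝ)).withDensity (fun x => f x θ))

/-- `g Y` is a unimodal-likelihood estimator of `θ`: at every observable value `x` of `Y` the
likelihood is non-decreasing in `θ ≤ g x` and non-increasing in `θ ≥ g x`. -/
def IsULE [MeasurableSpace Ω] (P : ℝ → Measure Ω) (Θ : Set ℝ) {n : ℕ}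
    (Y : Ω → Fin n → ℝ) (g : (Fin n → ℝ) → ℝ) : Prop :=
  ∃ f : (Fin n → ℝ) → ℝ → ℝ≥0∞, IsLikelihood P Θ Y f ∧
    ∀ ω, MonotoneOn (f (Y ω)) (Θ ∩ Set.Iic (g (Y ω))) ∧
      AntitoneOn (f (Y ω)) (Θ ∩ Set.Ici (g (Y ω)))

/-- Unimodal-likelihood consistent estimator. -/
structure IsULCE [MeasurableSpace Ω] (P : ℝ → Measure Ω) (Θ : Set ℝ) (X : ℕ → Ω → ℝ)
    (φ : (n : ℕ) → (Fin n → ℝ) → ℝ) : Prop where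
  measurable : ∀ n, Measurable (φ n)
  ule : ∀ n, 1 ≤ n → IsULE P Θ (sample X n) (φ n)
  consistent : ∀ θ ∈ Θ, TendstoInMeasure (P θ) (estimate X φ) atTop (fun _ => θ)

/-- Lower and upper confidence limits `L (φ_n, n, δ)`, `U (φ_n, n, δ)`, which always enclose the
estimator and each miss the parameter with probability at most `δ`. They may be infinite. -/
structure IsConfidenceLimits [MeasurableSpace Ω] (P : ℝ → Measure Ω) (Θ : Set ℝ)
    (X : ℕ → Ω → ℝ) (φ : (n : ℕ) → (Fin n → ℝ) → ℝ) (L U : ℝ → ℕ → ℝ → EReal) : Prop where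
  encloses : ∀ n, 1 ≤ n → ∀ δ ∈ Set.Ioo (0 : ℝ) 1, ∀ ω,
    L (estimate X φ n ω) n δ ≤ (estimate X φ n ω : EReal) ∧
      (estimate X φ n ω : EReal) ≤ U (estimate X φ n ω) n δ
  lower : ∀ n, 1 ≤ n → ∀ δ ∈ Set.Ioo (0 : ℝ) 1, ∀ θ ∈ Θ,
    P θ {ω | (θ : EReal) ≤ L (estimate X φ n ω) n δ} ≤ ENNReal.ofReal δ
  upper : ∀ n, 1 ≤ n → ∀ δ ∈ Set.Ioo (0 : ℝ) 1, ∀ θ ∈ Θ,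
    P θ {ω | U (estimate X φ n ω) n δ ≤ (θ : EReal)} ≤ ENNReal.ofReal δ

/-- A smaller error level `δ` gives a confidence interval that is at least as wide. -/
def NestedLimits (X : ℕ → Ω → ℝ) (φ : (n : ℕ) → (Fin n → ℝ) → ℝ)
    (L U : ℝ → ℕ → ℝ → EReal) : Prop :=
  ∀ n, 1 ≤ n → ∀ ω, MonotoneOn (L (estimate X φ n ω) n) (Set.Ioo 0 1) ∧
    AntitoneOn (U (estimate X φ n ω) n) (Set.Ioo 0 1)

/-- The cut points `θ_i = c i` and the end points `θ_i' = lo i`, `θ_i'' = hi i` of the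
indifference zone, `1 ≤ i ≤ m - 1`. -/
structure IsTestingProblem (Θ : Set ℝ) (m : ℕ) (c lo hi : ℕ → ℝ) : Prop where
  lo_mem : ∀ i, 1 ≤ i → i ≤ m - 1 → lo i ∈ Θ
  hi_mem : ∀ i, 1 ≤ i → i ≤ m - 1 → hi i ∈ Θ
  lo_lt : ∀ i, 1 ≤ i → i ≤ m - 1 → lo i < c i
  lt_hi : ∀ i, 1 ≤ i → i ≤ m - 1 → c i < hi i
  hi_le_lo : ∀ i, 1 ≤ i → i + 1 ≤ m - 1 → hi i ≤ lo (i + 1)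

/-- The parameter set `Θ_i` of hypothesis `H_i`, `0 ≤ i ≤ m - 1`. -/
def hypothesisSet (Θ : Set ℝ) (m : ℕ) (c : ℕ → ℝ) (i : ℕ) : Set ℝ :=
  {θ ∈ Θ | (i ≠ 0 → c i < θ) ∧ (i ≠ m - 1 → θ ≤ c (i + 1))}

/-- The part of `Θ_i` outside the indifference zone, on which the error is controlled. -/
def controlSet (Θ : Set ℝ) (m : ℕ) (c lo hi : ℕ → ℝ) (i : ℕ) : Set ℝ :=
  {θ ∈ hypothesisSet Θ m c i | (i ≠ 0 → hi i ≤ θ) ∧ (i ≠ m - 1 → θ ≤ lo (i + 1))}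

/-- `θ_i'`, with `θ_0' = -∞`. -/
noncomputable def lowerEnd (lo : ℕ → ℝ) (i : ℕ) : EReal := if i = 0 then ⊥ else (lo i : EReal)

/-- `θ_i''`, with `θ_m'' = ∞`. -/
noncomputable def upperEnd (m : ℕ) (hi : ℕ → ℝ) (i : ℕ) : EReal :=
  if i = m then ⊤ else (hi i : EReal)

/-- A multistage plan with `s` stages (numbered `1, …, s`) for `m` hypotheses: increasing sample
sizes, and at each stage a decision in `{0, …, m}` computed from the samples taken so far; `0`
means that sampling goes on, `i + 1` that `H_i` is accepted. -/
structure Plan (s m : ℕ) where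
  size : ℕ → ℕ
  decision : (ℓ : ℕ) → (Fin (size ℓ) → ℝ) → ℕ
  size_pos : ∀ ℓ, 1 ≤ ℓ → ℓ ≤ s → 1 ≤ size ℓ
  size_lt : ∀ k ℓ, 1 ≤ k → k < ℓ → ℓ ≤ s → size k < size ℓ
  decision_measurable : ∀ ℓ, 1 ≤ ℓ → ℓ ≤ s → Measurable (decision ℓ)
  decision_le : ∀ ℓ, 1 ≤ ℓ → ℓ ≤ s → ∀ x, decision ℓ x ≤ m

namespace Plan

variable {s m : ℕ}

/-- The decision variable `D_ℓ`. -/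
def D (T : Plan s m) (X : ℕ → Ω → ℝ) (ℓ : ℕ) (ω : Ω) : ℕ :=
  T.decision ℓ (sample X (T.size ℓ) ω)

/-- Sampling is terminated at stage `ℓ`. -/
def StopsAt (T : Plan s m) (X : ℕ → Ω → ℝ) (ω : Ω) (ℓ : ℕ) : Prop :=
  (1 ≤ ℓ ∧ ℓ ≤ s) ∧ T.D X ℓ ω ≠ 0 ∧ ∀ k, 1 ≤ k → k < ℓ → T.D X k ω = 0

/-- The event that `H_i` is accepted. -/
def accept (T : Plan s m) (X : ℕ → Ω → ℝ) (i : ℕ) : Set Ω :=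
  {ω | ∃ ℓ, T.StopsAt X ω ℓ ∧ T.D X ℓ ω = i + 1}

/-- The event that `H_i` is rejected, i.e. that another hypothesis is accepted. -/
def reject (T : Plan s m) (X : ℕ → Ω → ℝ) (i : ℕ) : Set Ω :=
  {ω | ∃ ℓ, T.StopsAt X ω ℓ ∧ T.D X ℓ ω ≠ i + 1}

/-- The index of the stage at which sampling is terminated. -/
noncomputable def stopStage (T : Plan s m) (X : ℕ → Ω → ℝ) (ω : Ω) : ℕ :=
  sInf {ℓ | T.StopsAt X ω ℓ}

/-- The overall estimator: the estimator at the stage of termination. -/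
noncomputable def finalEstimate (T : Plan s m) (X : ℕ → Ω → ℝ)
    (φ : (n : ℕ) → (Fin n → ℝ) → ℝ) (ω : Ω) : ℝ :=
  estimate X φ (T.size (T.stopStage X ω)) ω

/-- The plan terminates almost surely at stage `s` or earlier. -/
def IsClosed [MeasurableSpace Ω] (T : Plan s m) (P : ℝ → Measure Ω) (Θ : Set ℝ)
    (X : ℕ → Ω → ℝ) : Prop :=
  ∀ θ ∈ Θ, P θ {ω | T.D X s ω = 0} = 0

/-- The largest sample size `n_s` is no less than the smallest positive integer `n` for which
all the events `{θ_i' ≤ L (φ_n, n, α_i) ≤ U (φ_n, n, β_i) ≤ θ_i''}`, `1 ≤ i ≤ m - 1`, are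
possible. -/
def LargeEnough (T : Plan s m) (X : ℕ → Ω → ℝ) (φ : (n : ℕ) → (Fin n → ℝ) → ℝ)
    (L U : ℝ → ℕ → ℝ → EReal) (lo hi α β : ℕ → ℝ) : Prop :=
  ∃ n, 1 ≤ n ∧ n ≤ T.size s ∧ ∀ i, 1 ≤ i → i ≤ m - 1 → ∃ ω,
    (lo i : EReal) ≤ L (estimate X φ n ω) n (α i) ∧
      L (estimate X φ n ω) n (α i) ≤ U (estimate X φ n ω) n (β i) ∧
      U (estimate X φ n ω) n (β i) ≤ (hi i : EReal)

/-- The inclusion rule: `D_ℓ = i` only if the `(i-1)`-st controlling confidence interval at stage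
`ℓ` is included in the interval from `θ_{i-1}'` to `θ_i''`. -/
def ObeysInclusion (T : Plan s m) (X : ℕ → Ω → ℝ) (φ : (n : ℕ) → (Fin n → ℝ) → ℝ)
    (L U : ℝ → ℕ → ℝ → EReal) (lo hi α β : ℕ → ℝ) : Prop :=
  ∀ ℓ, 1 ≤ ℓ → ℓ ≤ s → ∀ i, 1 ≤ i → i ≤ m → ∀ ω, T.D X ℓ ω = i →
    lowerEnd lo (i - 1) ≤ L (estimate X φ (T.size ℓ) ω) (T.size ℓ) (α (i - 1)) ∧
    L (estimate X φ (T.size ℓ) ω) (T.size ℓ) (α (i - 1)) ≤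
      U (estimate X φ (T.size ℓ) ω) (T.size ℓ) (β i) ∧
    U (estimate X φ (T.size ℓ) ω) (T.size ℓ) (β i) ≤ upperEnd m hi i

end Plan

/-- The error levels `α_0, …, α_m` and `β_0, …, β_m` for one value of the tuning parameter. -/
structure IsLevels (m : ℕ) (α β : ℕ → ℝ) : Prop where
  alpha_mem : ∀ i, 1 ≤ i → i ≤ m - 1 → α i ∈ Set.Ioo (0 : ℝ) 1
  beta_mem : ∀ i, 1 ≤ i → i ≤ m - 1 → β i ∈ Set.Ioo (0 : ℝ) 1
  alpha_zero : α 0 = α 1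
  alpha_last : α m = 0
  beta_zero : β 0 = 0
  beta_last : β m = β (m - 1)

/-- I.i.d. observations with a moment generating function on all of `ℝ`, whose sample mean is
the estimator `φ_n` and is unbiased. -/
structure IsSampleMeanModel [MeasurableSpace Ω] (P : ℝ → Measure Ω) (Θ : Set ℝ)
    (X : ℕ → Ω → ℝ) (φ : (n : ℕ) → (Fin n → ℝ) → ℝ) : Prop where
  indep : ∀ θ ∈ Θ, iIndepFun X (P θ)
  ident : ∀ θ ∈ Θ, ∀ k, IdentDistrib (X k) (X 0) (P θ) (P θ)
  mgf_exists : ∀ θ ∈ Θ, ∀ ρ : ℝ, Integrable (fun ω => Real.exp (ρ * X 0 ω)) (P θ)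
  mean : ∀ n, 1 ≤ n → ∀ x, φ n x = (∑ k, x k) / n
  unbiased : ∀ θ ∈ Θ, ∀ n, 1 ≤ n → ∫ ω, estimate X φ n ω ∂(P θ) = θ

end InclusionTest

/-!
The monotonicity claims and the error bounds have separate sources.

*Monotonicity.* If an event `E` is decided by the first `n` observations and the estimator
satisfies `θ₂ ≤ φ_n` on `E`, then for `θ₁ ≤ θ₂` the likelihood at `θ₁` is at most that at `θ₂` on
all of `E`, so `P θ₁ E ≤ P θ₂ E` (`IsULE.measure_le_of_le_estimate`; symmetrically when
`φ_n ≤ θ₁`). The likelihoods need only be compared at observable values, since the remaining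
values have probability zero. An event described by the decision and the estimate at the stage of
termination (`Plan.outcome`) is a finite disjoint union, over the stage, of events of this kind,
so the comparison carries over to it. The inclusion rule does the rest: accepting `H_j` forces
`θ_j' ≤ L ≤ φ ≤ U ≤ θ_{j+1}''`, which places the estimate on a known side of every parameter
value outside the indifference zone.

*Error bounds.* If `H_j` is accepted at a stage and `θ ≤ θ_j'`, then `θ ≤ L(φ_n, n, α_j)` there,
an event of probability at most `α_j`; the union bound over the `s` stages gives `s α_j`. When
several `j` are possible, nested limits place all these events inside the one for the largest
level, so the union over `j` costs nothing (`measureReal_le_mul_sSup`). For the limit `ζ → 0` a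
union bound over the finitely many `j` is enough: the number of stages is fixed and each level is
`O(ζ)`.
-/

namespace InclusionTest

variable {Ω : Type*}

/-! ### Comparing probabilities through likelihoods -/

section Likelihood

variable [MeasurableSpace Ω] {P : ℝ → Measure Ω} {Θ : Set ℝ} {n : ℕ} {Y : Ω → Fin n → ℝ}

/-- It is enough to compare the likelihoods at values of `Y` that are attained on the event. -/
theorem IsLikelihood.measure_le {f : (Fin n → ℝ) → ℝ → ℝ≥0∞} (hf : IsLikelihood P Θ Y f)
    (hY : Measurable Y) {θ₁ θ₂ : ℝ} (h₁ : θ₁ ∈ Θ) (h₂ : θ₂ ∈ Θ) {E : Set Ω}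
    (hE : MeasurableSet[MeasurableSpace.comap Y inferInstance] E)
    (hle : ∀ ω ∈ E, f (Y ω) θ₁ ≤ f (Y ω) θ₂) : P θ₁ E ≤ P θ₂ E := by
  obtain ⟨B, hB, rfl⟩ := hE
  rcases hf with hf | hf
  · obtain ⟨⟨S, hS, hS0⟩, hf₁⟩ := hf θ₁ h₁
    obtain ⟨-, hf₂⟩ := hf θ₂ h₂
    have hC : (B ∩ S).Countable := hS.mono Set.inter_subset_right
    have key : ∀ θ, P θ (Y ⁻¹' (B ∩ S)) = ∑' x : ↥(B ∩ S), P θ {ω | Y ω = x} := by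
      intro θ
      have hU : Y ⁻¹' (B ∩ S) = ⋃ x ∈ B ∩ S, {ω | Y ω = x} := by
        ext ω
        simp
      rw [hU]
      refine measure_biUnion hC ?_ fun x _ => hY (measurableSet_singleton x)
      intro x _ y _ hxy
      exact Set.disjoint_left.2 fun ω hx hy => hxy (hx.symm.trans hy)
    calc P θ₁ (Y ⁻¹' B) ≤ P θ₁ (Y ⁻¹' (B ∩ S) ∪ {ω | Y ω ∉ S}) := by
          refine measure_mono fun ω hω => ?_
          by_cases h : Y ω ∈ S
          · exact Or.inl ⟨hω, h⟩
          · exact Or.inr h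
      _ ≤ P θ₁ (Y ⁻¹' (B ∩ S)) + 0 := hS0 ▸ measure_union_le _ _
      _ ≤ P θ₂ (Y ⁻¹' (B ∩ S)) := by
          rw [add_zero, key, key]
          refine ENNReal.tsum_le_tsum fun x => ?_
          by_cases hx : ∃ ω, Y ω = x
          · obtain ⟨ω, hω⟩ := hx
            rw [← hf₁, ← hf₂, ← hω]
            exact hle ω (by rw [Set.mem_preimage, hω]; exact x.2.1)
          · have : {ω | Y ω = x} = ∅ := Set.eq_empty_of_forall_notMem fun ω hω => hx ⟨ω, hω⟩
            simp [this]
      _ ≤ P θ₂ (Y ⁻¹' B) := measure_mono (Set.preimage_mono Set.inter_subset_left)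
  · obtain ⟨hm₁, hd₁⟩ := hf θ₁ h₁
    obtain ⟨hm₂, hd₂⟩ := hf θ₂ h₂
    set G : Set (Fin n → ℝ) := {x | f x θ₁ ≤ f x θ₂} with hG
    have hGm : MeasurableSet G := measurableSet_le hm₁ hm₂
    -- The range of `Y` need not be measurable, so the values with the wrong inequality are
    -- removed: their preimage under `Y` does not meet the event.
    have hEq : Y ⁻¹' B = Y ⁻¹' (B ∩ G) := by
      ext ω
      exact ⟨fun h => ⟨h, hle ω h⟩, fun h => h.1⟩
    have hBG := hB.inter hGm
    rw [hEq, ← Measure.map_apply hY hBG, ← Measure.map_apply hY hBG, hd₁, hd₂,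
      withDensity_apply _ hBG, withDensity_apply _ hBG]
    exact setLIntegral_mono hm₂ fun x hx => hx.2

theorem IsULE.measure_le_of_le_estimate {g : (Fin n → ℝ) → ℝ} (hg : IsULE P Θ Y g)
    (hY : Measurable Y) {θ₁ θ₂ : ℝ} (h₁ : θ₁ ∈ Θ) (h₂ : θ₂ ∈ Θ) (h : θ₁ ≤ θ₂) {E : Set Ω}
    (hE : MeasurableSet[MeasurableSpace.comap Y inferInstance] E)
    (hle : ∀ ω ∈ E, θ₂ ≤ g (Y ω)) : P θ₁ E ≤ P θ₂ E := by
  obtain ⟨f, hf, hmono⟩ := hg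
  exact hf.measure_le hY h₁ h₂ hE fun ω hω =>
    (hmono ω).1 ⟨h₁, h.trans (hle ω hω)⟩ ⟨h₂, hle ω hω⟩ h

theorem IsULE.measure_le_of_estimate_le {g : (Fin n → ℝ) → ℝ} (hg : IsULE P Θ Y g)
    (hY : Measurable Y) {θ₁ θ₂ : ℝ} (h₁ : θ₁ ∈ Θ) (h₂ : θ₂ ∈ Θ) (h : θ₁ ≤ θ₂) {E : Set Ω}
    (hE : MeasurableSet[MeasurableSpace.comap Y inferInstance] E)
    (hle : ∀ ω ∈ E, g (Y ω) ≤ θ₁) : P θ₂ E ≤ P θ₁ E := by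
  obtain ⟨f, hf, hmono⟩ := hg
  exact hf.measure_le hY h₂ h₁ hE fun ω hω =>
    (hmono ω).2 ⟨h₁, hle ω hω⟩ ⟨h₂, (hle ω hω).trans h⟩ h

end Likelihood

/-! ### Events decided at the stage of termination -/

theorem measurable_sample [MeasurableSpace Ω] {X : ℕ → Ω → ℝ} (hX : ∀ k, Measurable (X k))
    (n : ℕ) : Measurable (sample X n) :=
  measurable_pi_lambda _ fun k => hX k

theorem measurable_sample_of_le (X : ℕ → Ω → ℝ) {n N : ℕ} (h : n ≤ N) :
    Measurable[MeasurableSpace.comap (sample X N) inferInstance] (sample X n) := by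
  let _ : MeasurableSpace Ω := MeasurableSpace.comap (sample X N) inferInstance
  have hN : Measurable (sample X N) := comap_measurable _
  exact measurable_pi_lambda _ fun k =>
    (measurable_pi_apply (⟨k, k.2.trans_le h⟩ : Fin N)).comp hN

namespace Plan

variable {s m : ℕ} {T : Plan s m} {X : ℕ → Ω → ℝ}

theorem StopsAt.unique {ω : Ω} {k ℓ : ℕ} (hk : T.StopsAt X ω k) (hℓ : T.StopsAt X ω ℓ) :
    k = ℓ := by
  rcases lt_trichotomy k ℓ with h | h | h
  · exact absurd (hℓ.2.2 k hk.1.1 h) hk.2.1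
  · exact h
  · exact absurd (hk.2.2 ℓ hℓ.1.1 h) hℓ.2.1

theorem StopsAt.stopStage_eq {ω : Ω} {ℓ : ℕ} (h : T.StopsAt X ω ℓ) :
    T.stopStage X ω = ℓ := by
  have : {k | T.StopsAt X ω k} = {ℓ} := by
    ext k
    exact ⟨fun hk => StopsAt.unique hk h, fun hk => by rw [Set.mem_singleton_iff.1 hk]; exact h⟩
  rw [stopStage, this, csInf_singleton]

/-- The event that sampling terminates with the decision in `A` and the overall estimate in `C`. -/
def outcome (T : Plan s m) (X : ℕ → Ω → ℝ) (φ : (n : ℕ) → (Fin n → ℝ) → ℝ) (A : Set ℕ)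
    (C : Set ℝ) : Set Ω :=
  {ω | ∃ ℓ, T.StopsAt X ω ℓ ∧ T.D X ℓ ω ∈ A ∧ estimate X φ (T.size ℓ) ω ∈ C}

variable {φ : (n : ℕ) → (Fin n → ℝ) → ℝ}

variable (T X φ) in
theorem accept_eq_outcome (i : ℕ) : T.accept X i = T.outcome X φ {i + 1} Set.univ := by
  ext ω
  simp [accept, outcome]

variable (T X φ) in
theorem reject_eq_outcome (i : ℕ) : T.reject X i = T.outcome X φ {i + 1}ᶜ Set.univ := by
  ext ω
  simp [reject, outcome]

variable (T X φ) in
theorem reject_inter_reject_eq_outcome (i j : ℕ) :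
    T.reject X i ∩ T.reject X j = T.outcome X φ {i + 1, j + 1}ᶜ Set.univ := by
  ext ω
  constructor
  · rintro ⟨⟨ℓ, hℓ, hi⟩, ⟨k, hk, hj⟩⟩
    obtain rfl := StopsAt.unique hℓ hk
    exact ⟨ℓ, hℓ, by simp [hi, hj], trivial⟩
  · rintro ⟨ℓ, hℓ, h, -⟩
    simp only [Set.mem_compl_iff, Set.mem_insert_iff, Set.mem_singleton_iff, not_or] at h
    exact ⟨⟨ℓ, hℓ, h.1⟩, ⟨ℓ, hℓ, h.2⟩⟩

variable (T X φ) in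
theorem reject_inter_finalEstimate_eq_outcome (i : ℕ) (C : Set ℝ) :
    T.reject X i ∩ {ω | T.finalEstimate X φ ω ∈ C} = T.outcome X φ {i + 1}ᶜ C := by
  ext ω
  constructor
  · rintro ⟨⟨ℓ, hℓ, hi⟩, hC⟩
    rw [Set.mem_ofPred_eq, finalEstimate, hℓ.stopStage_eq] at hC
    exact ⟨ℓ, hℓ, hi, hC⟩
  · rintro ⟨ℓ, hℓ, hi, hC⟩
    refine ⟨⟨ℓ, hℓ, hi⟩, ?_⟩
    rwa [Set.mem_ofPred_eq, finalEstimate, hℓ.stopStage_eq]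

/-- The part of an outcome that belongs to termination at stage `ℓ` depends only on the
observations available at that stage. -/
theorem measurableSet_stage (T : Plan s m) (X : ℕ → Ω → ℝ) (hφ : ∀ n, Measurable (φ n))
    {A : Set ℕ} {C : Set ℝ} (hC : MeasurableSet C) {ℓ : ℕ} (h1 : 1 ≤ ℓ) (hs : ℓ ≤ s) :
    MeasurableSet[MeasurableSpace.comap (sample X (T.size ℓ)) inferInstance]
      {ω | T.StopsAt X ω ℓ ∧ T.D X ℓ ω ∈ A ∧ estimate X φ (T.size ℓ) ω ∈ C} := by
  let _ : MeasurableSpace Ω := MeasurableSpace.comap (sample X (T.size ℓ)) inferInstance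
  have hD : ∀ k, 1 ≤ k → k ≤ ℓ → Measurable (T.D X k) := fun k hk hkℓ =>
    (T.decision_measurable k hk (hkℓ.trans hs)).comp <| measurable_sample_of_le X <| by
      rcases hkℓ.lt_or_eq with h | rfl
      · exact (T.size_lt k ℓ hk h hs).le
      · exact le_rfl
  have hest : Measurable (estimate X φ (T.size ℓ)) :=
    (hφ _).comp (measurable_sample_of_le X le_rfl)
  have hterm : MeasurableSet {ω | T.StopsAt X ω ℓ} := by
    have : {ω | T.StopsAt X ω ℓ} =
        (T.D X ℓ ⁻¹' {0})ᶜ ∩ ⋂ k ∈ Set.Ico 1 ℓ, T.D X k ⁻¹' {0} := by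
      ext ω
      simp [StopsAt, h1, hs]
    rw [this]
    exact (hD ℓ h1 le_rfl (measurableSet_singleton 0)).compl.inter <|
      MeasurableSet.biInter (Set.to_countable _) fun k hk =>
        hD k hk.1 hk.2.le (measurableSet_singleton 0)
  exact hterm.inter ((hD ℓ h1 le_rfl (MeasurableSet.of_discrete (s := A))).inter (hest hC))

theorem outcome_eq_biUnion (T : Plan s m) (X : ℕ → Ω → ℝ) (φ : (n : ℕ) → (Fin n → ℝ) → ℝ)
    (A : Set ℕ) (C : Set ℝ) : T.outcome X φ A C = ⋃ ℓ ∈ Finset.Icc 1 s,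
      {ω | T.StopsAt X ω ℓ ∧ T.D X ℓ ω ∈ A ∧ estimate X φ (T.size ℓ) ω ∈ C} := by
  ext ω
  simp only [outcome, Set.mem_ofPred_eq, Set.mem_iUnion, Finset.mem_Icc, exists_prop]
  exact ⟨fun ⟨ℓ, h⟩ => ⟨ℓ, h.1.1, h⟩, fun ⟨ℓ, _, h⟩ => ⟨ℓ, h⟩⟩

section Measure

variable [MeasurableSpace Ω]

theorem measurableSet_stage_of_measurable (T : Plan s m) (hX : ∀ k, Measurable (X k))
    (hφ : ∀ n, Measurable (φ n)) {A : Set ℕ} {C : Set ℝ} (hC : MeasurableSet C) {ℓ : ℕ}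
    (h1 : 1 ≤ ℓ) (hs : ℓ ≤ s) :
    MeasurableSet {ω | T.StopsAt X ω ℓ ∧ T.D X ℓ ω ∈ A ∧ estimate X φ (T.size ℓ) ω ∈ C} :=
  (measurable_sample hX _).comap_le _ (T.measurableSet_stage X hφ hC h1 hs)

theorem measurableSet_outcome (T : Plan s m) (hX : ∀ k, Measurable (X k))
    (hφ : ∀ n, Measurable (φ n)) {A : Set ℕ} {C : Set ℝ} (hC : MeasurableSet C) :
    MeasurableSet (T.outcome X φ A C) := by
  rw [outcome_eq_biUnion]
  exact Finset.measurableSet_biUnion _ fun ℓ hℓ =>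
    T.measurableSet_stage_of_measurable hX hφ hC (Finset.mem_Icc.1 hℓ).1 (Finset.mem_Icc.1 hℓ).2

theorem measure_outcome (T : Plan s m) (hX : ∀ k, Measurable (X k))
    (hφ : ∀ n, Measurable (φ n)) {A : Set ℕ} {C : Set ℝ} (hC : MeasurableSet C)
    (μ : Measure Ω) : μ (T.outcome X φ A C) = ∑ ℓ ∈ Finset.Icc 1 s,
      μ {ω | T.StopsAt X ω ℓ ∧ T.D X ℓ ω ∈ A ∧ estimate X φ (T.size ℓ) ω ∈ C} := by
  rw [outcome_eq_biUnion]
  refine measure_biUnion_finset ?_ fun ℓ hℓ =>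
    T.measurableSet_stage_of_measurable hX hφ hC (Finset.mem_Icc.1 hℓ).1 (Finset.mem_Icc.1 hℓ).2
  intro k _ ℓ _ hkℓ
  exact Set.disjoint_left.2 fun ω hk hℓ => hkℓ (hk.1.unique hℓ.1)

variable {P : ℝ → Measure Ω} {Θ : Set ℝ}

theorem measureReal_outcome_le_of_le_estimate (T : Plan s m)
    (hP : ∀ θ ∈ Θ, IsProbabilityMeasure (P θ)) (hX : ∀ k, Measurable (X k))
    (hφ : IsULCE P Θ X φ) {A : Set ℕ} {C : Set ℝ} (hC : MeasurableSet C) {θ₁ θ₂ : ℝ}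
    (h₁ : θ₁ ∈ Θ) (h₂ : θ₂ ∈ Θ) (h : θ₁ ≤ θ₂)
    (hle : ∀ ω ℓ, T.StopsAt X ω ℓ → T.D X ℓ ω ∈ A → estimate X φ (T.size ℓ) ω ∈ C →
      θ₂ ≤ estimate X φ (T.size ℓ) ω) :
    (P θ₁).real (T.outcome X φ A C) ≤ (P θ₂).real (T.outcome X φ A C) := by
  have := hP θ₂ h₂
  refine ENNReal.toReal_mono (measure_ne_top _ _) ?_
  rw [measure_outcome T hX hφ.measurable hC, measure_outcome T hX hφ.measurable hC]
  refine Finset.sum_le_sum fun ℓ hℓ => ?_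
  obtain ⟨h1, hs⟩ := Finset.mem_Icc.1 hℓ
  exact (hφ.ule _ (T.size_pos ℓ h1 hs)).measure_le_of_le_estimate (measurable_sample hX _)
    h₁ h₂ h (T.measurableSet_stage X hφ.measurable hC h1 hs)
    fun ω hω => hle ω ℓ hω.1 hω.2.1 hω.2.2

theorem measureReal_outcome_le_of_estimate_le (T : Plan s m)
    (hP : ∀ θ ∈ Θ, IsProbabilityMeasure (P θ)) (hX : ∀ k, Measurable (X k))
    (hφ : IsULCE P Θ X φ) {A : Set ℕ} {C : Set ℝ} (hC : MeasurableSet C) {θ₁ θ₂ : ℝ}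
    (h₁ : θ₁ ∈ Θ) (h₂ : θ₂ ∈ Θ) (h : θ₁ ≤ θ₂)
    (hle : ∀ ω ℓ, T.StopsAt X ω ℓ → T.D X ℓ ω ∈ A → estimate X φ (T.size ℓ) ω ∈ C →
      estimate X φ (T.size ℓ) ω ≤ θ₁) :
    (P θ₂).real (T.outcome X φ A C) ≤ (P θ₁).real (T.outcome X φ A C) := by
  have := hP θ₁ h₁
  refine ENNReal.toReal_mono (measure_ne_top _ _) ?_
  rw [measure_outcome T hX hφ.measurable hC, measure_outcome T hX hφ.measurable hC]
  refine Finset.sum_le_sum fun ℓ hℓ => ?_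
  obtain ⟨h1, hs⟩ := Finset.mem_Icc.1 hℓ
  exact (hφ.ule _ (T.size_pos ℓ h1 hs)).measure_le_of_estimate_le (measurable_sample hX _)
    h₁ h₂ h (T.measurableSet_stage X hφ.measurable hC h1 hs)
    fun ω hω => hle ω ℓ hω.1 hω.2.1 hω.2.2

end Measure

end Plan

/-! ### Union bounds -/

section UnionBound

variable [MeasurableSpace Ω] {μ : Measure Ω}

theorem measureReal_le_mul_of_stage [IsFiniteMeasure μ] {s : ℕ} {δ : ℝ} (hδ : 0 ≤ δ)
    (F : ℕ → Set Ω) (hF : ∀ ℓ, 1 ≤ ℓ → ℓ ≤ s → μ (F ℓ) ≤ ENNReal.ofReal δ) {E : Set Ω}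
    (hE : ∀ ω ∈ E, ∃ ℓ, 1 ≤ ℓ ∧ ℓ ≤ s ∧ ω ∈ F ℓ) : μ.real E ≤ s * δ := by
  have hsub : E ⊆ ⋃ ℓ ∈ Finset.Icc 1 s, F ℓ := fun ω hω => by
    obtain ⟨ℓ, h1, hs, h⟩ := hE ω hω
    exact Set.mem_biUnion (Finset.mem_coe.2 (Finset.mem_Icc.2 ⟨h1, hs⟩)) h
  calc μ.real E ≤ μ.real (⋃ ℓ ∈ Finset.Icc 1 s, F ℓ) := measureReal_mono hsub (measure_ne_top _ _)
    _ ≤ ∑ ℓ ∈ Finset.Icc 1 s, μ.real (F ℓ) := measureReal_biUnion_finset_le _ _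
    _ ≤ ∑ _ℓ ∈ Finset.Icc 1 s, δ := Finset.sum_le_sum fun ℓ hℓ =>
        ENNReal.toReal_le_of_le_ofReal hδ
          (hF ℓ (Finset.mem_Icc.1 hℓ).1 (Finset.mem_Icc.1 hℓ).2)
    _ = s * δ := by simp

/-- A union bound over stages only, although the level `γ j` of the event covering `ω` may vary
with `ω`: if the events `F · ℓ` grow with the level, those of the largest level contain all the
others. The levels are indexed by `I`; the larger index set `J` in the bound accommodates levels
that are zero by convention. -/
theorem measureReal_le_mul_sSup [IsFiniteMeasure μ] {s : ℕ} (F : ℝ → ℕ → Set Ω)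
    (hF : ∀ δ ∈ Set.Ioo (0 : ℝ) 1, ∀ ℓ, 1 ≤ ℓ → ℓ ≤ s → μ (F δ ℓ) ≤ ENNReal.ofReal δ)
    {γ : ℕ → ℝ} {I J : Set ℕ} (hIJ : I ⊆ J) (hJ : J.Finite)
    (hγI : ∀ j ∈ I, γ j ∈ Set.Ioo (0 : ℝ) 1)
    (hγJ : ∀ j ∈ J, 0 ≤ γ j)
    (hnest : I.Subsingleton ∨ ∀ ℓ, 1 ≤ ℓ → ℓ ≤ s → MonotoneOn (fun δ => F δ ℓ) (Set.Ioo 0 1))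
    {E : Set Ω} (hE : ∀ ω ∈ E, ∃ ℓ, 1 ≤ ℓ ∧ ℓ ≤ s ∧ ∃ j ∈ I, ω ∈ F (γ j) ℓ) :
    μ.real E ≤ s * sSup (γ '' J) := by
  rcases I.eq_empty_or_nonempty with rfl | hne
  · have : E = ∅ := Set.eq_empty_of_forall_notMem fun ω hω => by
      obtain ⟨_, _, _, j, hj, _⟩ := hE ω hω
      exact hj
    rw [this, measureReal_empty]
    refine mul_nonneg (Nat.cast_nonneg s) (Real.sSup_nonneg ?_)
    rintro _ ⟨j, hj, rfl⟩
    exact hγJ j hj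
  · obtain ⟨i, hi, hmax⟩ := Set.exists_max_image I γ (hJ.subset hIJ) hne
    have h1 : μ.real E ≤ s * γ i := by
      refine measureReal_le_mul_of_stage (hγI i hi).1.le (F (γ i)) (hF _ (hγI i hi)) ?_
      intro ω hω
      obtain ⟨ℓ, h1, hs, j, hj, h⟩ := hE ω hω
      refine ⟨ℓ, h1, hs, ?_⟩
      rcases hnest with hsub | hmono
      · rwa [hsub hi hj]
      · exact hmono ℓ h1 hs (hγI j hj) (hγI i hi) (hmax j hj) h
    refine h1.trans (mul_le_mul_of_nonneg_left ?_ (Nat.cast_nonneg s))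
    exact le_csSup (hJ.image γ).bddAbove ⟨i, hIJ hi, rfl⟩

end UnionBound

/-! ### Consequences of the inclusion rule -/

namespace IsTestingProblem

variable {Θ : Set ℝ} {m : ℕ} {c lo hi : ℕ → ℝ}

theorem lo_le_lo (h : IsTestingProblem Θ m c lo hi) {i j : ℕ} (hi1 : 1 ≤ i) (hij : i ≤ j)
    (hj : j ≤ m - 1) : lo i ≤ lo j := by
  induction j, hij using Nat.le_induction with
  | base => exact le_rfl
  | succ k hk ih =>
    exact (ih (by omega)).trans <| ((h.lo_lt k (by omega) (by omega)).trans
      (h.lt_hi k (by omega) (by omega))).le.trans (h.hi_le_lo k (by omega) hj)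

theorem hi_le_hi (h : IsTestingProblem Θ m c lo hi) {i j : ℕ} (hi1 : 1 ≤ i) (hij : i ≤ j)
    (hj : j ≤ m - 1) : hi i ≤ hi j := by
  induction j, hij using Nat.le_induction with
  | base => exact le_rfl
  | succ k hk ih =>
    exact (ih (by omega)).trans <| (h.hi_le_lo k (by omega) hj).trans
      ((h.lo_lt (k + 1) (by omega) hj).trans (h.lt_hi (k + 1) (by omega) hj)).le

end IsTestingProblem

section Inclusion

variable {X : ℕ → Ω → ℝ} {φ : (n : ℕ) → (Fin n → ℝ) → ℝ} {L U : ℝ → ℕ → ℝ → EReal} {s m : ℕ}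
  {T : Plan s m} {lo hi α β : ℕ → ℝ}

/-- Accepting `H_j` with `j ≠ 0` puts `θ_j'` below the lower confidence limit. -/
theorem lo_le_lower (hincl : T.ObeysInclusion X φ L U lo hi α β) {ω : Ω} {ℓ j : ℕ}
    (hst : T.StopsAt X ω ℓ) (hD : T.D X ℓ ω = j + 1) (h1 : 1 ≤ j) (hj : j ≤ m - 1) :
    (lo j : EReal) ≤ L (estimate X φ (T.size ℓ) ω) (T.size ℓ) (α j) := by
  have := (hincl ℓ hst.1.1 hst.1.2 (j + 1) (by omega) (by omega) ω hD).1
  rwa [Nat.add_sub_cancel, lowerEnd, if_neg (by omega)] at this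

/-- Accepting `H_j` with `j ≠ m - 1` puts `θ_{j+1}''` above the upper confidence limit. -/
theorem upper_le_hi (hincl : T.ObeysInclusion X φ L U lo hi α β) {ω : Ω} {ℓ j : ℕ}
    (hst : T.StopsAt X ω ℓ) (hD : T.D X ℓ ω = j + 1) (hj : j + 1 ≤ m - 1) :
    U (estimate X φ (T.size ℓ) ω) (T.size ℓ) (β (j + 1)) ≤ (hi (j + 1) : EReal) := by
  have := (hincl ℓ hst.1.1 hst.1.2 (j + 1) (by omega) (by omega) ω hD).2.2
  rwa [upperEnd, if_neg (by omega)] at this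

theorem exists_hypothesis {ω : Ω} {ℓ : ℕ} (hst : T.StopsAt X ω ℓ) :
    ∃ j, j ≤ m - 1 ∧ T.D X ℓ ω = j + 1 := by
  have h0 := hst.2.1
  have hle : T.D X ℓ ω ≤ m := T.decision_le ℓ hst.1.1 hst.1.2 _
  exact ⟨T.D X ℓ ω - 1, by omega, by omega⟩

variable [MeasurableSpace Ω] {P : ℝ → Measure Ω} {Θ : Set ℝ}

theorem lo_le_estimate (hincl : T.ObeysInclusion X φ L U lo hi α β) (hlev : IsLevels m α β)
    (hLU : IsConfidenceLimits P Θ X φ L U) {ω : Ω} {ℓ j : ℕ} (hst : T.StopsAt X ω ℓ)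
    (hD : T.D X ℓ ω = j + 1) (h1 : 1 ≤ j) (hj : j ≤ m - 1) :
    lo j ≤ estimate X φ (T.size ℓ) ω :=
  EReal.coe_le_coe_iff.1 <| (lo_le_lower hincl hst hD h1 hj).trans
    (hLU.encloses _ (T.size_pos ℓ hst.1.1 hst.1.2) _ (hlev.alpha_mem j h1 hj) ω).1

theorem estimate_le_hi (hincl : T.ObeysInclusion X φ L U lo hi α β) (hlev : IsLevels m α β)
    (hLU : IsConfidenceLimits P Θ X φ L U) {ω : Ω} {ℓ j : ℕ} (hst : T.StopsAt X ω ℓ)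
    (hD : T.D X ℓ ω = j + 1) (hj : j + 1 ≤ m - 1) :
    estimate X φ (T.size ℓ) ω ≤ hi (j + 1) :=
  EReal.coe_le_coe_iff.1 <| (hLU.encloses _ (T.size_pos ℓ hst.1.1 hst.1.2) _
    (hlev.beta_mem (j + 1) (by omega) hj) ω).2.trans (upper_le_hi hincl hst hD hj)

/-- If `θ` is at most `θ_j'` for every accepted hypothesis `H_j`, `j ∈ I`, then the event is
covered by the failures of the lower confidence limit. -/
theorem measureReal_le_mul_sSup_alpha (hP : ∀ θ ∈ Θ, IsProbabilityMeasure (P θ))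
    (hincl : T.ObeysInclusion X φ L U lo hi α β) (hlev : IsLevels m α β)
    (hLU : IsConfidenceLimits P Θ X φ L U) {I J : Set ℕ} (hI : I ⊆ Set.Icc 1 (m - 1))
    (hIJ : I ⊆ J) (hJ : J ⊆ Set.Icc 1 m) (hnest : I.Subsingleton ∨ NestedLimits X φ L U)
    {θ : ℝ} (hθ : θ ∈ Θ) (hlo : ∀ j ∈ I, θ ≤ lo j) {E : Set Ω}
    (hE : ∀ ω ∈ E, ∃ ℓ, T.StopsAt X ω ℓ ∧ ∃ j ∈ I, T.D X ℓ ω = j + 1) :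
    (P θ).real E ≤ s * sSup (α '' J) := by
  have := hP θ hθ
  refine measureReal_le_mul_sSup
    (fun δ ℓ => {ω | (θ : EReal) ≤ L (estimate X φ (T.size ℓ) ω) (T.size ℓ) δ})
    (fun δ hδ ℓ h1 hs => hLU.lower _ (T.size_pos ℓ h1 hs) δ hδ θ hθ) hIJ
    ((Set.finite_Icc 1 m).subset hJ) (fun j hj => hlev.alpha_mem j (hI hj).1 (hI hj).2)
    (fun j hj => ?_) (hnest.imp id fun hn ℓ h1 hs δ hδ δ' hδ' hle ω hω => ?_) fun ω hω => ?_
  · rcases eq_or_ne j m with rfl | hjm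
    · exact hlev.alpha_last.ge
    · have h1 := (hJ hj).1
      have h2 := (hJ hj).2
      exact (hlev.alpha_mem j h1 (by omega)).1.le
  · exact le_trans hω ((hn _ (T.size_pos ℓ h1 hs) ω).1 hδ hδ' hle)
  · obtain ⟨ℓ, hst, j, hj, hD⟩ := hE ω hω
    exact ⟨ℓ, hst.1.1, hst.1.2, j, hj, (EReal.coe_le_coe_iff.2 (hlo j hj)).trans
      (lo_le_lower hincl hst hD (hI hj).1 (hI hj).2)⟩

/-- The mirror image of `measureReal_le_mul_sSup_alpha`: here `j ∈ I` labels the acceptance of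
`H_{j-1}`, whose upper end point is `θ_j''`. -/
theorem measureReal_le_mul_sSup_beta (hP : ∀ θ ∈ Θ, IsProbabilityMeasure (P θ))
    (hincl : T.ObeysInclusion X φ L U lo hi α β) (hlev : IsLevels m α β)
    (hLU : IsConfidenceLimits P Θ X φ L U) {I J : Set ℕ} (hI : I ⊆ Set.Icc 1 (m - 1))
    (hIJ : I ⊆ J) (hJ : J ⊆ Set.Icc 0 (m - 1))
    (hnest : I.Subsingleton ∨ NestedLimits X φ L U)
    {θ : ℝ} (hθ : θ ∈ Θ) (hhi : ∀ j ∈ I, hi j ≤ θ) {E : Set Ω}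
    (hE : ∀ ω ∈ E, ∃ ℓ, T.StopsAt X ω ℓ ∧ T.D X ℓ ω ∈ I) :
    (P θ).real E ≤ s * sSup (β '' J) := by
  have := hP θ hθ
  refine measureReal_le_mul_sSup
    (fun δ ℓ => {ω | U (estimate X φ (T.size ℓ) ω) (T.size ℓ) δ ≤ (θ : EReal)})
    (fun δ hδ ℓ h1 hs => hLU.upper _ (T.size_pos ℓ h1 hs) δ hδ θ hθ) hIJ
    ((Set.finite_Icc 0 (m - 1)).subset hJ) (fun j hj => hlev.beta_mem j (hI hj).1 (hI hj).2)
    (fun j hj => ?_) (hnest.imp id fun hn ℓ h1 hs δ hδ δ' hδ' hle ω hω => ?_) fun ω hω => ?_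
  · rcases Nat.eq_zero_or_pos j with rfl | hj0
    · exact hlev.beta_zero.ge
    · exact (hlev.beta_mem j hj0 (hJ hj).2).1.le
  · exact le_trans ((hn _ (T.size_pos ℓ h1 hs) ω).2 hδ hδ' hle) hω
  · obtain ⟨ℓ, hst, hD⟩ := hE ω hω
    obtain ⟨j, -, hj⟩ := exists_hypothesis hst
    rw [hj] at hD
    exact ⟨ℓ, hst.1.1, hst.1.2, j + 1, hD, (upper_le_hi hincl hst hj (hI hD).2).trans
      (EReal.coe_le_coe_iff.2 (hhi _ hD))⟩

/-! ### Error probabilities of a single plan -/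

theorem measureReal_accept_le_alpha (hP : ∀ θ ∈ Θ, IsProbabilityMeasure (P θ))
    (hincl : T.ObeysInclusion X φ L U lo hi α β) (hlev : IsLevels m α β)
    (hLU : IsConfidenceLimits P Θ X φ L U) {i : ℕ} (h1 : 1 ≤ i) (him : i ≤ m - 1)
    {θ : ℝ} (hθ : θ ∈ Θ) (hlo : θ ≤ lo i) : (P θ).real (T.accept X i) ≤ s * α i := by
  have := measureReal_le_mul_sSup_alpha (I := {i}) (J := {i}) (E := T.accept X i) hP hincl hlev
    hLU (by simp [h1, him]) le_rfl (by simp only [Set.singleton_subset_iff, Set.mem_Icc]; omega)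
    (Or.inl Set.subsingleton_singleton) hθ
    (by simpa using hlo) fun _ hω => hω.imp fun _ h => ⟨h.1, i, rfl, h.2⟩
  simpa using this

theorem measureReal_accept_le_beta (hP : ∀ θ ∈ Θ, IsProbabilityMeasure (P θ))
    (hincl : T.ObeysInclusion X φ L U lo hi α β) (hlev : IsLevels m α β)
    (hLU : IsConfidenceLimits P Θ X φ L U) {i : ℕ} (him : i + 1 ≤ m - 1)
    {θ : ℝ} (hθ : θ ∈ Θ) (hhi : hi (i + 1) ≤ θ) :
    (P θ).real (T.accept X i) ≤ s * β (i + 1) := by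
  have := measureReal_le_mul_sSup_beta (I := {i + 1}) (J := {i + 1}) (E := T.accept X i) hP hincl
    hlev hLU (by simp [him]) le_rfl (by simp [him])
    (Or.inl Set.subsingleton_singleton) hθ
    (by simpa using hhi) fun _ hω => hω
  simpa using this

variable {c : ℕ → ℝ}

theorem controlSet_subset (i : ℕ) : controlSet Θ m c lo hi i ⊆ Θ := fun _ h => h.1.1

theorem le_lo_of_mem_controlSet (hprob : IsTestingProblem Θ m c lo hi) {i j : ℕ} {θ : ℝ}
    (hθ : θ ∈ controlSet Θ m c lo hi i) (hij : i < j) (hj : j ≤ m - 1) : θ ≤ lo j :=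
  (hθ.2.2 (by omega)).trans (hprob.lo_le_lo (by omega) hij hj)

theorem hi_le_of_mem_controlSet (hprob : IsTestingProblem Θ m c lo hi) {i j : ℕ} {θ : ℝ}
    (hθ : θ ∈ controlSet Θ m c lo hi i) (h1 : 1 ≤ j) (hj : j ≤ i) (him : i ≤ m - 1) :
    hi j ≤ θ :=
  (hprob.hi_le_hi h1 hj him).trans (hθ.2.1 (by omega))

theorem measureReal_reject_le (hP : ∀ θ ∈ Θ, IsProbabilityMeasure (P θ))
    (hprob : IsTestingProblem Θ m c lo hi)
    (hincl : T.ObeysInclusion X φ L U lo hi α β) (hlev : IsLevels m α β)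
    (hLU : IsConfidenceLimits P Θ X φ L U) (hnest : 3 ≤ m → NestedLimits X φ L U) {i : ℕ}
    (him : i ≤ m - 1) {θ : ℝ} (hθ : θ ∈ controlSet Θ m c lo hi i) :
    (P θ).real (T.reject X i) ≤ s * (sSup (α '' Set.Ioc i m) + sSup (β '' Set.Icc 0 i)) := by
  have hθΘ := controlSet_subset i hθ
  have := hP θ hθΘ
  have hnest' : ∀ I ⊆ Set.Icc 1 (m - 1), I.Subsingleton ∨ NestedLimits X φ L U := by
    intro I hI
    rcases Nat.lt_or_ge m 3 with h | h
    · refine Or.inl fun x hx y hy => ?_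
      have hx' := Set.mem_Icc.1 (hI hx)
      have hy' := Set.mem_Icc.1 (hI hy)
      omega
    · exact Or.inr (hnest h)
  have hsub : T.reject X i ⊆
      {ω | ∃ ℓ, T.StopsAt X ω ℓ ∧ ∃ j ∈ Set.Ioc i (m - 1), T.D X ℓ ω = j + 1} ∪
        {ω | ∃ ℓ, T.StopsAt X ω ℓ ∧ T.D X ℓ ω ∈ Set.Icc 1 i} := by
    rintro ω ⟨ℓ, hst, hD⟩
    obtain ⟨j, hj, hDj⟩ := exists_hypothesis hst
    rcases Nat.lt_or_ge i j with h | h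
    · exact Or.inl ⟨ℓ, hst, j, ⟨h, hj⟩, hDj⟩
    · exact Or.inr ⟨ℓ, hst, by rw [Set.mem_Icc]; omega⟩
  rw [mul_add]
  refine (measureReal_mono hsub).trans ((measureReal_union_le _ _).trans (add_le_add ?_ ?_))
  · have hI : Set.Ioc i (m - 1) ⊆ Set.Icc 1 (m - 1) := fun j hj => ⟨by have := hj.1; omega, hj.2⟩
    refine measureReal_le_mul_sSup_alpha (J := Set.Ioc i m) hP hincl hlev hLU hI
      (fun j hj => ⟨hj.1, by have := hj.2; omega⟩) (fun j hj => ⟨by have := hj.1; omega, hj.2⟩)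
      (hnest' _ hI) hθΘ (fun j hj => le_lo_of_mem_controlSet hprob hθ hj.1 hj.2)
      fun ω hω => hω
  · have hI : Set.Icc 1 i ⊆ Set.Icc 1 (m - 1) := fun j hj => ⟨hj.1, hj.2.trans him⟩
    exact measureReal_le_mul_sSup_beta (J := Set.Icc 0 i) hP hincl hlev hLU hI
      (fun j hj => ⟨Nat.zero_le j, hj.2⟩) (fun j hj => ⟨hj.1, hj.2.trans him⟩)
      (hnest' _ hI) hθΘ (fun j hj => hi_le_of_mem_controlSet hprob hθ hj.1 hj.2 him)
      fun ω hω => hω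

/-- A union bound over the stages and over the wrong hypotheses, valid also for limits that are not
nested. -/
theorem measureReal_reject_le_sum (hP : ∀ θ ∈ Θ, IsProbabilityMeasure (P θ))
    (hprob : IsTestingProblem Θ m c lo hi)
    (hincl : T.ObeysInclusion X φ L U lo hi α β) (hlev : IsLevels m α β)
    (hLU : IsConfidenceLimits P Θ X φ L U) {i : ℕ}
    (him : i ≤ m - 1) {θ : ℝ} (hθ : θ ∈ controlSet Θ m c lo hi i) :
    (P θ).real (T.reject X i) ≤
      ∑ j ∈ Finset.Ioc i (m - 1), s * α j + ∑ j ∈ Finset.range i, s * β (j + 1) := by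
  have hθΘ := controlSet_subset i hθ
  have := hP θ hθΘ
  have hsub : T.reject X i ⊆
      (⋃ j ∈ Finset.Ioc i (m - 1), T.accept X j) ∪ ⋃ j ∈ Finset.range i, T.accept X j := by
    rintro ω ⟨ℓ, hst, hD⟩
    obtain ⟨j, hj, hDj⟩ := exists_hypothesis hst
    rcases Nat.lt_or_ge i j with h | h
    · exact Or.inl (Set.mem_iUnion₂.2 ⟨j, Finset.mem_Ioc.2 ⟨h, hj⟩, ℓ, hst, hDj⟩)
    · exact Or.inr (Set.mem_iUnion₂.2
        ⟨j, Finset.mem_range.2 (show j < i by omega), ℓ, hst, hDj⟩)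
  refine (measureReal_mono hsub).trans ((measureReal_union_le _ _).trans (add_le_add ?_ ?_))
  · refine (measureReal_biUnion_finset_le _ _).trans (Finset.sum_le_sum fun j hj => ?_)
    rw [Finset.mem_Ioc] at hj
    exact measureReal_accept_le_alpha hP hincl hlev hLU (by omega) hj.2 hθΘ
      (le_lo_of_mem_controlSet hprob hθ hj.1 hj.2)
  · refine (measureReal_biUnion_finset_le _ _).trans (Finset.sum_le_sum fun j hj => ?_)
    rw [Finset.mem_range] at hj
    exact measureReal_accept_le_beta hP hincl hlev hLU (by omega) hθΘ
      (hi_le_of_mem_controlSet hprob hθ (by omega) hj him)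

/-! ### Monotonicity for a single plan -/

/-- If every hypothesis `H_j` accepted on an outcome has `j ≥ k ≥ 1`, then the estimate is at
least `θ_k'`, and the probability of the outcome increases up to `θ_k'`. -/
theorem monotoneOn_outcome (hP : ∀ θ ∈ Θ, IsProbabilityMeasure (P θ))
    (hX : ∀ k, Measurable (X k)) (hprob : IsTestingProblem Θ m c lo hi) (hφ : IsULCE P Θ X φ)
    (hincl : T.ObeysInclusion X φ L U lo hi α β) (hlev : IsLevels m α β)
    (hLU : IsConfidenceLimits P Θ X φ L U) {A : Set ℕ} {k : ℕ} (hk : 1 ≤ k)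
    (hA : ∀ j ≤ m - 1, j + 1 ∈ A → k ≤ j) :
    MonotoneOn (fun θ => (P θ).real (T.outcome X φ A Set.univ)) (Θ ∩ Set.Iic (lo k)) := by
  intro θ₁ h₁ θ₂ h₂ h
  refine T.measureReal_outcome_le_of_le_estimate hP hX hφ MeasurableSet.univ h₁.1 h₂.1 h ?_
  intro ω ℓ hst hDA _
  obtain ⟨j, hj, hD⟩ := exists_hypothesis hst
  have hkj := hA j hj (hD ▸ hDA)
  exact le_trans h₂.2 ((hprob.lo_le_lo hk hkj hj).trans
    (lo_le_estimate hincl hlev hLU hst hD (hk.trans hkj) hj))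

/-- If every hypothesis `H_j` accepted on an outcome has `j < k ≤ m - 1`, then the estimate is at
most `θ_k''`, and the probability of the outcome decreases from `θ_k''` on. -/
theorem antitoneOn_outcome (hP : ∀ θ ∈ Θ, IsProbabilityMeasure (P θ))
    (hX : ∀ k, Measurable (X k)) (hprob : IsTestingProblem Θ m c lo hi) (hφ : IsULCE P Θ X φ)
    (hincl : T.ObeysInclusion X φ L U lo hi α β) (hlev : IsLevels m α β)
    (hLU : IsConfidenceLimits P Θ X φ L U) {A : Set ℕ} {k : ℕ} (hk : k ≤ m - 1)
    (hA : ∀ j ≤ m - 1, j + 1 ∈ A → j < k) :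
    AntitoneOn (fun θ => (P θ).real (T.outcome X φ A Set.univ)) (Θ ∩ Set.Ici (hi k)) := by
  intro θ₁ h₁ θ₂ h₂ h
  refine T.measureReal_outcome_le_of_estimate_le hP hX hφ MeasurableSet.univ h₁.1 h₂.1 h ?_
  intro ω ℓ hst hDA _
  obtain ⟨j, hj, hD⟩ := exists_hypothesis hst
  have hjk : j + 1 ≤ k := hA j hj (hD ▸ hDA)
  exact (estimate_le_hi hincl hlev hLU hst hD (hjk.trans hk)).trans
    ((hprob.hi_le_hi (by omega) hjk hk).trans h₁.2)

theorem controlSet_zero_subset (hm : 2 ≤ m) :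
    controlSet Θ m c lo hi 0 ⊆ Θ ∩ Set.Iic (lo 1) :=
  fun _ h => ⟨h.1.1, h.2.2 (by omega)⟩

theorem controlSet_last_subset (hm : 2 ≤ m) :
    controlSet Θ m c lo hi (m - 1) ⊆ Θ ∩ Set.Ici (hi (m - 1)) :=
  fun _ h => ⟨h.1.1, h.2.1 (by omega)⟩

/-- On rejection of an inner hypothesis the estimate avoids the open interval between any two
points of its control set, which splits the event into two outcomes on which the likelihood is
monotone between the two points. -/
theorem measureReal_reject_between (hP : ∀ θ ∈ Θ, IsProbabilityMeasure (P θ))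
    (hX : ∀ k, Measurable (X k)) (hprob : IsTestingProblem Θ m c lo hi) (hφ : IsULCE P Θ X φ)
    (hincl : T.ObeysInclusion X φ L U lo hi α β) (hlev : IsLevels m α β)
    (hLU : IsConfidenceLimits P Θ X φ L U) {i : ℕ} (him : i ≤ m - 1)
    {a b θ : ℝ} (ha : a ∈ controlSet Θ m c lo hi i) (hb : b ∈ controlSet Θ m c lo hi i)
    (hθ : θ ∈ Θ) (haθ : a ≤ θ) (hθb : θ ≤ b) :
    (P θ).real (T.reject X i) ≤
        (P a).real (T.reject X i ∩ {ω | T.finalEstimate X φ ω ≤ a}) +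
        (P b).real (T.reject X i ∩ {ω | b ≤ T.finalEstimate X φ ω}) ∧
      (a < b →
        (P b).real (T.reject X i ∩ {ω | T.finalEstimate X φ ω ≤ a}) +
        (P a).real (T.reject X i ∩ {ω | b ≤ T.finalEstimate X φ ω}) ≤
          (P θ).real (T.reject X i)) := by
  have := hP θ hθ
  have haΘ := controlSet_subset i ha
  have hbΘ := controlSet_subset i hb
  have hlow : T.reject X i ∩ {ω | T.finalEstimate X φ ω ≤ a} =
      T.outcome X φ {i + 1}ᶜ (Set.Iic a) :=
    T.reject_inter_finalEstimate_eq_outcome X φ i (Set.Iic a)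
  have hupp : T.reject X i ∩ {ω | b ≤ T.finalEstimate X φ ω} =
      T.outcome X φ {i + 1}ᶜ (Set.Ici b) :=
    T.reject_inter_finalEstimate_eq_outcome X φ i (Set.Ici b)
  have hcover : T.reject X i =
      T.outcome X φ {i + 1}ᶜ (Set.Iic a) ∪ T.outcome X φ {i + 1}ᶜ (Set.Ici b) := by
    refine Set.Subset.antisymm ?_ (hlow ▸ hupp ▸
      Set.union_subset Set.inter_subset_left Set.inter_subset_left)
    rintro ω ⟨ℓ, hst, hD⟩
    obtain ⟨j, hj, hDj⟩ := exists_hypothesis hst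
    rcases Nat.lt_or_ge i j with h | h
    · exact Or.inr ⟨ℓ, hst, hD, (le_lo_of_mem_controlSet hprob hb h hj).trans
        (lo_le_estimate hincl hlev hLU hst hDj (by omega) hj)⟩
    · exact Or.inl ⟨ℓ, hst, hD,
        (estimate_le_hi hincl hlev hLU hst hDj (show j + 1 ≤ m - 1 by omega)).trans
          (hi_le_of_mem_controlSet hprob ha (by omega) (by omega) him)⟩
  have decr : ∀ {θ₁ θ₂ : ℝ}, θ₁ ∈ Θ → θ₂ ∈ Θ → a ≤ θ₁ → θ₁ ≤ θ₂ →
      (P θ₂).real (T.outcome X φ {i + 1}ᶜ (Set.Iic a)) ≤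
        (P θ₁).real (T.outcome X φ {i + 1}ᶜ (Set.Iic a)) := fun h₁ h₂ h h' =>
    T.measureReal_outcome_le_of_estimate_le hP hX hφ measurableSet_Iic h₁ h₂ h'
      fun _ _ _ _ hC => le_trans hC h
  have incr : ∀ {θ₁ θ₂ : ℝ}, θ₁ ∈ Θ → θ₂ ∈ Θ → θ₁ ≤ θ₂ → θ₂ ≤ b →
      (P θ₁).real (T.outcome X φ {i + 1}ᶜ (Set.Ici b)) ≤
        (P θ₂).real (T.outcome X φ {i + 1}ᶜ (Set.Ici b)) := fun h₁ h₂ h' h =>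
    T.measureReal_outcome_le_of_le_estimate hP hX hφ measurableSet_Ici h₁ h₂ h'
      fun _ _ _ _ hC => le_trans h hC
  rw [hlow, hupp, hcover]
  refine ⟨(measureReal_union_le _ _).trans
    (add_le_add (decr haΘ hθ le_rfl haθ) (incr hθ hbΘ hθb le_rfl)), fun hab => ?_⟩
  have hdisj : Disjoint (T.outcome X φ {i + 1}ᶜ (Set.Iic a))
      (T.outcome X φ {i + 1}ᶜ (Set.Ici b)) := by
    refine Set.disjoint_left.2 ?_
    rintro ω ⟨ℓ, hst, -, h⟩ ⟨k, hst', -, h'⟩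
    obtain rfl := hst.unique hst'
    exact absurd (le_trans (Set.mem_Ici.1 h') (Set.mem_Iic.1 h)) hab.not_ge
  rw [measureReal_union hdisj (T.measurableSet_outcome hX hφ.measurable measurableSet_Ici)]
  exact add_le_add (decr hθ hbΘ haθ hθb) (incr haΘ hθ haθ hθb)

/-- Rejecting both extreme hypotheses means accepting one of `H_1, …, H_{m-2}`. -/
theorem measureReal_reject_extremes_le (hP : ∀ θ ∈ Θ, IsProbabilityMeasure (P θ))
    (hm : 3 ≤ m) (hprob : IsTestingProblem Θ m c lo hi)
    (hincl : T.ObeysInclusion X φ L U lo hi α β) (hlev : IsLevels m α β)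
    (hLU : IsConfidenceLimits P Θ X φ L U) (hnest : 4 ≤ m → NestedLimits X φ L U) :
    (∀ θ ∈ controlSet Θ m c lo hi 0,
      (P θ).real (T.reject X 0 ∩ T.reject X (m - 1)) ≤ s * sSup (α '' Set.Icc 1 (m - 2))) ∧
    (∀ θ ∈ controlSet Θ m c lo hi (m - 1),
      (P θ).real (T.reject X 0 ∩ T.reject X (m - 1)) ≤
        s * sSup (β '' Set.Icc 2 (m - 1))) := by
  have hnest' : ∀ u, (Set.Icc (u + 1) (u + (m - 2))).Subsingleton ∨ NestedLimits X φ L U := by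
    intro u
    rcases Nat.lt_or_ge m 4 with h | h
    · refine Or.inl fun x hx y hy => ?_
      rw [Set.mem_Icc] at hx hy
      omega
    · exact Or.inr (hnest h)
  have hE : ∀ ω ∈ T.reject X 0 ∩ T.reject X (m - 1),
      ∃ ℓ, T.StopsAt X ω ℓ ∧ ∃ j ∈ Set.Icc 1 (m - 2), T.D X ℓ ω = j + 1 := by
    rintro ω ⟨⟨ℓ, hst, hD⟩, ⟨k, hst', hD'⟩⟩
    obtain rfl := hst.unique hst'
    obtain ⟨j, hj, hDj⟩ := exists_hypothesis hst
    exact ⟨ℓ, hst, j, by rw [Set.mem_Icc]; omega, hDj⟩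
  have hα' : Set.Icc 1 (m - 2) ⊆ Set.Icc 1 (m - 1) := Set.Icc_subset_Icc_right (by omega)
  refine ⟨fun θ hθ => ?_, fun θ hθ => ?_⟩
  · refine measureReal_le_mul_sSup_alpha hP hincl hlev hLU hα' le_rfl
      (Set.Icc_subset_Icc_right (by omega)) ?_ (controlSet_subset 0 hθ)
      (fun j hj => le_lo_of_mem_controlSet hprob hθ hj.1 (hα' hj).2) hE
    have := hnest' 0
    rwa [zero_add, zero_add] at this
  · refine measureReal_le_mul_sSup_beta hP hincl hlev hLU
      (Set.Icc_subset_Icc_left (by omega)) le_rfl (Set.Icc_subset_Icc_left (by omega)) ?_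
      (controlSet_subset _ hθ)
      (fun j hj => hi_le_of_mem_controlSet hprob hθ (by have := hj.1; omega) hj.2 le_rfl)
      fun ω hω => ?_
    · have := hnest' 1
      rwa [show 1 + (m - 2) = m - 1 by omega] at this
    · obtain ⟨ℓ, hst, j, hj, hD⟩ := hE ω hω
      rw [Set.mem_Icc] at hj
      exact ⟨ℓ, hst, by rw [hD, Set.mem_Icc]; omega⟩

end Inclusion

end InclusionTest

open InclusionTest in
theorem theorem5 {Ω : Type*} [MeasurableSpace Ω]
    -- the statistical model: laws `P θ`, `θ ∈ Θ`, and observations `X 0, X 1, …`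
    (Θ : Set ℝ) (P : ℝ → Measure Ω) (hP : ∀ θ ∈ Θ, IsProbabilityMeasure (P θ))
    (X : ℕ → Ω → ℝ) (hX : ∀ k, Measurable (X k))
    -- the hypotheses and the indifference zone
    (m : ℕ) (hm : 2 ≤ m) (c lo hi : ℕ → ℝ) (hprob : IsTestingProblem Θ m c lo hi)
    -- the estimator and the confidence limits
    (φ : (n : ℕ) → (Fin n → ℝ) → ℝ) (hφ : IsULCE P Θ X φ)
    (L U : ℝ → ℕ → ℝ → EReal) (hLU : IsConfidenceLimits P Θ X φ L U)
    -- the error levels as functions of the tuning parameter `ζ`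
    (ζ₀ : ℝ) (hζ₀ : 0 < ζ₀) (α β : ℝ → ℕ → ℝ)
    (hlev : ∀ ζ ∈ Set.Ioo 0 ζ₀, IsLevels m (α ζ) (β ζ))
    (hα : ∀ i, 1 ≤ i → i ≤ m - 1 → (fun ζ => α ζ i) =O[𝓝[>] 0] (fun ζ : ℝ => ζ))
    (hβ : ∀ i, 1 ≤ i → i ≤ m - 1 → (fun ζ => β ζ i) =O[𝓝[>] 0] (fun ζ : ℝ => ζ))
    -- the multistage plans
    (s : ℕ) (hs : 1 ≤ s) (T : ℝ → Plan s m)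
    (hclosed : ∀ ζ ∈ Set.Ioo 0 ζ₀, (T ζ).IsClosed P Θ X)
    (hsize : ∀ ζ ∈ Set.Ioo 0 ζ₀, (T ζ).LargeEnough X φ L U lo hi (α ζ) (β ζ))
    (hincl : ∀ ζ ∈ Set.Ioo 0 ζ₀, (T ζ).ObeysInclusion X φ L U lo hi (α ζ) (β ζ)) :
    (∀ ζ ∈ Set.Ioo 0 ζ₀,
      -- (I)
      MonotoneOn (fun θ => (P θ).real ((T ζ).reject X 0)) (controlSet Θ m c lo hi 0) ∧
      -- (II)
      AntitoneOn (fun θ => (P θ).real ((T ζ).reject X (m - 1)))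
        (controlSet Θ m c lo hi (m - 1)) ∧
      -- (III)
      ((3 ≤ m → NestedLimits X φ L U) → ∀ i, i ≤ m - 1 → ∀ θ ∈ controlSet Θ m c lo hi i,
        (P θ).real ((T ζ).reject X i) ≤
          s * (sSup (α ζ '' Set.Ioc i m) + sSup (β ζ '' Set.Icc 0 i))) ∧
      -- (IV)
      (∀ i, 0 < i → i ≤ m - 1 →
        (∀ θ ∈ Θ, θ ≤ lo i → (P θ).real ((T ζ).accept X i) ≤ s * α ζ i) ∧
        MonotoneOn (fun θ => (P θ).real ((T ζ).accept X i)) (Θ ∩ Set.Iic (lo i))) ∧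
      -- (V)
      (∀ i, i ≤ m - 2 →
        (∀ θ ∈ Θ, hi (i + 1) ≤ θ → (P θ).real ((T ζ).accept X i) ≤ s * β ζ (i + 1)) ∧
        AntitoneOn (fun θ => (P θ).real ((T ζ).accept X i)) (Θ ∩ Set.Ici (hi (i + 1))))) ∧
    -- (VI)
    (IsSampleMeanModel P Θ X φ → ∀ i, i ≤ m - 1 → ∀ θ ∈ controlSet Θ m c lo hi i,
      Tendsto (fun ζ => (P θ).real ((T ζ).reject X i)) (𝓝[>] 0) (𝓝 0)) ∧
    (3 ≤ m → ∀ ζ ∈ Set.Ioo 0 ζ₀,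
      -- (VII)
      (∀ i, 1 ≤ i → i ≤ m - 2 → ∀ a ∈ controlSet Θ m c lo hi i,
        ∀ b ∈ controlSet Θ m c lo hi i, ∀ θ ∈ Θ, a ≤ θ → θ ≤ b →
        (P θ).real ((T ζ).reject X i) ≤
          (P a).real ((T ζ).reject X i ∩ {ω | (T ζ).finalEstimate X φ ω ≤ a}) +
          (P b).real ((T ζ).reject X i ∩ {ω | b ≤ (T ζ).finalEstimate X φ ω}) ∧
        (a < b →
          (P b).real ((T ζ).reject X i ∩ {ω | (T ζ).finalEstimate X φ ω ≤ a}) +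
          (P a).real ((T ζ).reject X i ∩ {ω | b ≤ (T ζ).finalEstimate X φ ω}) ≤
            (P θ).real ((T ζ).reject X i))) ∧
      -- (VIII)
      (MonotoneOn (fun θ => (P θ).real ((T ζ).reject X 0 ∩ (T ζ).reject X (m - 1)))
          (controlSet Θ m c lo hi 0) ∧
        AntitoneOn (fun θ => (P θ).real ((T ζ).reject X 0 ∩ (T ζ).reject X (m - 1)))
          (controlSet Θ m c lo hi (m - 1))) ∧
      -- (IX)
      ((4 ≤ m → NestedLimits X φ L U) →
        (∀ θ ∈ controlSet Θ m c lo hi 0,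
          (P θ).real ((T ζ).reject X 0 ∩ (T ζ).reject X (m - 1)) ≤
            s * sSup (α ζ '' Set.Icc 1 (m - 2))) ∧
        (∀ θ ∈ controlSet Θ m c lo hi (m - 1),
          (P θ).real ((T ζ).reject X 0 ∩ (T ζ).reject X (m - 1)) ≤
            s * sSup (β ζ '' Set.Icc 2 (m - 1))))) := by
  refine ⟨fun ζ hζ => ⟨?_, ?_, ?_, ?_, ?_⟩, ?_, fun hm3 ζ hζ => ⟨?_, ⟨?_, ?_⟩, ?_⟩⟩
  · simp only [Plan.reject_eq_outcome (T ζ) X φ]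
    refine (monotoneOn_outcome hP hX hprob hφ (hincl ζ hζ) (hlev ζ hζ) hLU le_rfl
      fun j hj hA => ?_).mono (controlSet_zero_subset hm)
    rw [Set.mem_compl_singleton_iff] at hA
    omega
  · simp only [Plan.reject_eq_outcome (T ζ) X φ]
    refine (antitoneOn_outcome hP hX hprob hφ (hincl ζ hζ) (hlev ζ hζ) hLU le_rfl
      fun j hj hA => ?_).mono (controlSet_last_subset hm)
    rw [Set.mem_compl_singleton_iff] at hA
    omega
  · exact fun hn i hi θ hθ =>
      measureReal_reject_le hP hprob (hincl ζ hζ) (hlev ζ hζ) hLU hn hi hθ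
  · refine fun i hi0 him => ⟨fun θ hθ hlo =>
      measureReal_accept_le_alpha hP (hincl ζ hζ) (hlev ζ hζ) hLU hi0 him hθ hlo, ?_⟩
    simp only [Plan.accept_eq_outcome (T ζ) X φ]
    refine monotoneOn_outcome hP hX hprob hφ (hincl ζ hζ) (hlev ζ hζ) hLU hi0 fun j hj hA => ?_
    rw [Set.mem_singleton_iff] at hA
    omega
  · refine fun i him => ⟨fun θ hθ hhi =>
      measureReal_accept_le_beta hP (hincl ζ hζ) (hlev ζ hζ) hLU (by omega) hθ hhi, ?_⟩
    simp only [Plan.accept_eq_outcome (T ζ) X φ]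
    refine antitoneOn_outcome hP hX hprob hφ (hincl ζ hζ) (hlev ζ hζ) hLU (by omega)
      fun j hj hA => ?_
    rw [Set.mem_singleton_iff] at hA
    omega
  · intro _ i him θ hθ
    have hid : Tendsto (fun ζ : ℝ => ζ) (𝓝[>] 0) (𝓝 0) :=
      tendsto_nhdsWithin_of_tendsto_nhds tendsto_id
    have hbound : Tendsto (fun ζ => ∑ j ∈ Finset.Ioc i (m - 1), s * α ζ j +
        ∑ j ∈ Finset.range i, s * β ζ (j + 1)) (𝓝[>] 0) (𝓝 0) := by
      have h1 : Tendsto (fun ζ => ∑ j ∈ Finset.Ioc i (m - 1), s * α ζ j) (𝓝[>] 0)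
          (𝓝 (∑ j ∈ Finset.Ioc i (m - 1), (s : ℝ) * 0)) :=
        tendsto_finsetSum _ fun j hj => by
          rw [Finset.mem_Ioc] at hj
          exact ((hα j (by omega) hj.2).trans_tendsto hid).const_mul _
      have h2 : Tendsto (fun ζ => ∑ j ∈ Finset.range i, s * β ζ (j + 1)) (𝓝[>] 0)
          (𝓝 (∑ j ∈ Finset.range i, (s : ℝ) * 0)) :=
        tendsto_finsetSum _ fun j hj => by
          rw [Finset.mem_range] at hj
          exact ((hβ (j + 1) (by omega) (by omega)).trans_tendsto hid).const_mul _
      simpa using h1.add h2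
    refine tendsto_of_tendsto_of_tendsto_of_le_of_le' tendsto_const_nhds hbound
      (Eventually.of_forall fun ζ => measureReal_nonneg) ?_
    filter_upwards [Ioo_mem_nhdsGT hζ₀] with ζ hζ
    exact measureReal_reject_le_sum hP hprob (hincl ζ hζ) (hlev ζ hζ) hLU him hθ
  · exact fun i _ him a ha b hb θ hθ haθ hθb =>
      measureReal_reject_between hP hX hprob hφ (hincl ζ hζ) (hlev ζ hζ) hLU (by omega)
        ha hb hθ haθ hθb
  · simp only [Plan.reject_inter_reject_eq_outcome (T ζ) X φ]
    refine (monotoneOn_outcome hP hX hprob hφ (hincl ζ hζ) (hlev ζ hζ) hLU le_rfl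
      fun j hj hA => ?_).mono (controlSet_zero_subset hm)
    simp only [Set.mem_compl_iff, Set.mem_insert_iff, Set.mem_singleton_iff, not_or] at hA
    omega
  · simp only [Plan.reject_inter_reject_eq_outcome (T ζ) X φ]
    refine (antitoneOn_outcome hP hX hprob hφ (hincl ζ hζ) (hlev ζ hζ) hLU le_rfl
      fun j hj hA => ?_).mono (controlSet_last_subset hm)
    simp only [Set.mem_compl_iff, Set.mem_insert_iff, Set.mem_singleton_iff, not_or] at hA
    omega
  · exact fun hn => measureReal_reject_extremes_le hP hm3 hprob (hincl ζ hζ) (hlev ζ hζ) hLU hn
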